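/- Let $\alpha$ be an infinite cardinal. All topological groups are assumed to be Hausdorff (hence Tychonoff). A topological space $X$ is called $\alpha$-pseudocompact if $f(X)$ is compact for every continuous map $f:X\to\mathbb R^\alpha$. A $G_\alpha$-set of $X$ is an intersection of $\alpha$ many (not necessarily distinct) open subsets of $X$, and a subset of $X$ is $G_\alpha$-dense in $X$ if it meets every non-empty $G_\alpha$-set of $X$. The weight $w(X)$ is the least cardinality of a base of the topology of $X$. Let $(G,\tau)$ be an $\alpha$-pseudocompact topological group (not necessarily abelian), let $H$ be an $\alpha$-pseudocompact abelian topological group with $|H|>1$, and let $h:G\to H$ be a (not necessarily continuous) group homomorphism whose graph $\Gamma_h=\{(x,h(x)):x\in G\}$ is $G_\alpha$-dense in the product space $(G,\tau)\times H$. Then: (a) there exists an $\alpha$-pseudocompact Hausdorff group topology $\tau'$ on $G$, strictly finer than $\tau$, such that $w(G,\tau')=w(G,\tau)$; (b) there exists a proper subgroup $D$ of $G$ that is $G_\alpha$-dense in $(G,\tau)$ and satisfies $w(D)=w(G,\tau)$, where $D$ carries the subspace topology. -/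

import Mathlib

open scoped Cardinal

universe u v w

/-- A topological space `X` is `α`-pseudocompact if every continuous map from `X` to `ℝ ^ α`
(with the product topology) has compact image. -/
def AlphaPseudocompact (α : Cardinal.{v}) (X : Type u) [TopologicalSpace X] : Prop :=
  ∀ f : X → (α.out → ℝ), Continuous f → IsCompact (Set.range f)

/-- A `G_α`-set is an intersection of `α` many (not necessarily distinct) open sets. -/
def IsGAlphaSet (α : Cardinal.{v}) {X : Type u} [TopologicalSpace X] (s : Set X) : Prop :=
  ∃ U : α.out → Set X, (∀ i, IsOpen (U i)) ∧ s = ⋂ i, U i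

/-- A subset is `G_α`-dense if it meets every non-empty `G_α`-set. -/
def IsGAlphaDense (α : Cardinal.{v}) {X : Type u} [TopologicalSpace X] (D : Set X) : Prop :=
  ∀ W : Set X, IsGAlphaSet α W → W.Nonempty → (W ∩ D).Nonempty

/-- The weight of a topological space: the least cardinality of a base of its topology. -/
noncomputable def topWeight (X : Type u) [TopologicalSpace X] : Cardinal.{u} :=
  sInf {c : Cardinal.{u} | ∃ B : Set (Set X), TopologicalSpace.IsTopologicalBasis B ∧ #B = c}

/-!
The homomorphism `h` serves only to pull a coarse topology back to `G`. A sequence of successive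
square roots of a neighborhood of `1` in `H` generates a coarser group topology `σ` (here `H` is
abelian), non-trivial and pseudometrizable; pseudocompactness of `H` makes it compact, hence second
countable (`compactSpace_of_continuous_bddAbove`). Inseparability classes of `σ` are `G_δ`-sets of
`H`, so `G_α`-density of the graph says that the topology `ρ` induced by `h` and `σ` on `G` is
transversal to `τ`: every non-empty `G_α`-set of `τ` meets every class of `ρ`-inseparable points
(`exists_transversal`). In particular `ρ` is a compact second countable group topology.

The finer topology is `τ' = τ ⊓ ρ`, and the subgroup `D` is the `ρ`-class of `1`; transversality
gives strictness, properness and `G_α`-density at once.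

The difficult point is that `τ'` is `α`-pseudocompact. It is reduced to the following property
(`HasCompactCoarsenings`): for any `α` neighborhoods of `1`, some compact topology on `G` has all
their left translates among its neighborhoods. For `τ` itself, the neighborhoods are detected by a
continuous map `Φ` to `ℝ ^ α`, whose image is compact. For `τ'`, the topology `induced Φ ⊓ ρ` works:
a limit of an ultrafilter for `induced Φ` and one for `ρ` can be replaced by a common limit, because
the fibers of `Φ` are `G_α`-sets (`compactSpace_inf_induced`). Conversely, the property for
countable families forces continuous real functions to be left uniformly continuous
(`HasCompactCoarsenings.exists_nhds_dist_lt`), and so a continuous map to `ℝ ^ α`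
stays continuous for a suitable compact topology and has compact image.

For the weights, an almost open homomorphism with dense range does not raise the weight
(`topWeight_le_of_denseRange`). This applies to the inclusion of a dense subgroup and to the
identity from `τ'` to `τ`; the reverse inequalities are elementary, as the weight of `G` is infinite.
-/

open Filter Topology Set TopologicalSpace

/-! ### Pseudocompactness and coarser pseudometrizable topologies -/

/-- A pseudometrizable space on which every continuous real function is bounded above is compact.
A sequence without cluster points would carry a locally finite family of bumps, the `n`-th of
height `n`. -/
theorem compactSpace_of_continuous_bddAbove {X : Type*} [TopologicalSpace X]
    [TopologicalSpace.PseudoMetrizableSpace X]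
    (hX : ∀ f : X → ℝ, Continuous f → BddAbove (range f)) : CompactSpace X := by
  let := TopologicalSpace.pseudoMetrizableSpacePseudoMetric X
  rw [compactSpace_iff_seqCompactSpace]
  by_contra hcon
  have hseq : ∃ u : ℕ → X, ∀ x, ¬ MapClusterPt x atTop u := by
    by_contra! hno
    refine hcon ⟨fun u _ => ?_⟩
    obtain ⟨x, hx⟩ := hno u
    obtain ⟨φ, hφ, hlim⟩ := hx.tendsto_subseq
    exact ⟨x, mem_univ x, φ, hφ, hlim⟩
  obtain ⟨u, hu⟩ := hseq
  have hfar : ∀ x, ∃ δ > 0, ∀ᶠ n in atTop, δ ≤ dist (u n) x := by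
    intro x
    have := hu x
    rw [Metric.nhds_basis_ball.mapClusterPt_iff_frequently] at this
    push Not at this
    obtain ⟨δ, hδ, h⟩ := this
    exact ⟨δ, hδ, h.mono fun n hn => by simpa using hn⟩
  -- The `n`-th bump has height `n` and lives on the ball of radius `1 / (n + 1)` around `u n`.
  let g : ℕ → X → ℝ := fun n x => n * max 0 (1 - (n + 1) * dist x (u n))
  have hg0 : ∀ n x, 0 ≤ g n x := fun n x => by positivity
  have hgc : ∀ n, Continuous (g n) := fun n => by fun_prop
  have hlf : LocallyFinite fun n => Function.support (g n) := by
    intro x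
    obtain ⟨δ, hδ, hev⟩ := hfar x
    obtain ⟨N, hN⟩ := exists_nat_one_div_lt (half_pos hδ)
    obtain ⟨M, hM⟩ := eventually_atTop.1 hev
    refine ⟨Metric.ball x (δ / 2), Metric.ball_mem_nhds _ (half_pos hδ),
      (finite_lt_nat (max M N)).subset ?_⟩
    rintro n ⟨y, hy, hyx⟩
    by_contra hn
    simp only [mem_ofPred_eq, not_lt, max_le_iff] at hn
    refine hy ?_
    have h1 : δ / 2 < dist y (u n) := by
      have h2 := hM n hn.1
      have h3 := dist_triangle_left (u n) x y
      rw [Metric.mem_ball] at hyx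
      linarith
    have h4 : (1 : ℝ) ≤ (n + 1) * dist y (u n) := by
      have h5 : (1 : ℝ) / (n + 1) ≤ 1 / (N + 1) := by
        have : (N : ℝ) ≤ n := by exact_mod_cast hn.2
        gcongr
      have h6 : (1 : ℝ) / (n + 1) ≤ dist y (u n) := by linarith
      rwa [div_le_iff₀' (by positivity)] at h6
    simp only [g]
    rw [max_eq_left (by linarith), mul_zero]
  obtain ⟨C, hC⟩ := hX (fun x => ∑ᶠ n, g n x) (continuous_finsum hgc hlf)
  obtain ⟨n, hn⟩ := exists_nat_gt C
  have h1 : g n (u n) ≤ ∑ᶠ m, g m (u n) :=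
    single_le_finsum (f := fun m => g m (u n)) n (hlf.point_finite (u n)) fun m => hg0 m _
  have h2 : g n (u n) = n := by simp [g]
  have h3 : ∑ᶠ m, g m (u n) ≤ C := hC ⟨u n, rfl⟩
  linarith

/-- A separable pseudometrizable space has the topology induced by countably many real functions,
the distances to the points of a dense sequence. -/
theorem exists_nhds_eq_comap_nat_real (X : Type*) [TopologicalSpace X]
    [TopologicalSpace.PseudoMetrizableSpace X] [TopologicalSpace.SeparableSpace X] [Nonempty X] :
    ∃ φ : X → ℕ → ℝ, Continuous φ ∧ ∀ x, 𝓝 x = comap φ (𝓝 (φ x)) := by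
  let := TopologicalSpace.pseudoMetrizableSpacePseudoMetric X
  let q := TopologicalSpace.denseSeq X
  refine ⟨fun x n => dist x (q n), by fun_prop, fun x => le_antisymm ?_ ?_⟩
  · exact (Continuous.tendsto (by fun_prop) x).le_comap
  · rw [Metric.nhds_basis_ball.ge_iff]
    intro ε hε
    obtain ⟨n, hn⟩ := (TopologicalSpace.denseRange_denseSeq X).exists_dist_lt x
      (show 0 < ε / 2 by linarith)
    refine ⟨{z | z n < ε / 2}, (isOpen_lt (continuous_apply n) continuous_const).mem_nhds hn, ?_⟩
    intro y hy
    have h1 : dist y (q n) < ε / 2 := hy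
    have h2 := dist_triangle_right y x (q n)
    have h3 : dist x (q n) < ε / 2 := hn
    rw [Metric.mem_ball]
    linarith

theorem secondCountableTopology_of_compactSpace (X : Type*) [TopologicalSpace X]
    [TopologicalSpace.PseudoMetrizableSpace X] [CompactSpace X] : SecondCountableTopology X := by
  let := TopologicalSpace.pseudoMetrizableSpacePseudoMetric X
  infer_instance

/-- An infinite index set of cardinality `α` absorbs a factor `ℕ`. -/
theorem nonempty_equiv_out_prod_nat {α : Cardinal.{v}} (hα : ℵ₀ ≤ α) :
    Nonempty (α.out ≃ α.out × ℕ) := by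
  rw [← Cardinal.eq]
  simp [Cardinal.mk_prod, Cardinal.mul_aleph0_eq hα]

theorem nonempty_out {α : Cardinal.{v}} (hα : ℵ₀ ≤ α) : Nonempty α.out := by
  rw [← Cardinal.mk_ne_zero_iff, Cardinal.mk_out]
  exact (Cardinal.aleph0_pos.trans_le hα).ne'

theorem AlphaPseudocompact.bddAbove_range {α : Cardinal.{v}} (hα : ℵ₀ ≤ α) {X : Type u}
    [TopologicalSpace X] (hX : AlphaPseudocompact α X) (f : X → ℝ) (hf : Continuous f) :
    BddAbove (range f) := by
  obtain ⟨i⟩ := nonempty_out hα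
  have h := (hX (fun x _ => f x) (by fun_prop)).image (continuous_apply i)
  rw [← range_comp] at h
  exact h.bddAbove

theorem AlphaPseudocompact.compactSpace_of_le {α : Cardinal.{v}} (hα : ℵ₀ ≤ α) {X : Type u}
    {τ σ : TopologicalSpace X} (hX : @AlphaPseudocompact α X τ) (hle : τ ≤ σ)
    (hσ : @TopologicalSpace.PseudoMetrizableSpace X σ) : @CompactSpace X σ :=
  @compactSpace_of_continuous_bddAbove X σ hσ fun f hf =>
    @AlphaPseudocompact.bddAbove_range α hα X τ hX f (continuous_le_dom hle hf)

/-! ### Left-invariant uniformities generated by a sequence -/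

/-- A sequence of symmetric subsets of a group containing `1`, the square of each of which lies in
the preceding one: a base at `1` of a left-invariant uniformity. -/
structure IsSquareRootSeq {G : Type*} [Group G] (U : ℕ → Set G) : Prop where
  one_mem : ∀ n, 1 ∈ U n
  inv_mem : ∀ n, ∀ x ∈ U n, x⁻¹ ∈ U n
  mul_mem : ∀ n, ∀ x ∈ U (n + 1), ∀ y ∈ U (n + 1), x * y ∈ U n

namespace IsSquareRootSeq

variable {G : Type*} [Group G] {U : ℕ → Set G}

theorem antitone (hU : IsSquareRootSeq U) : Antitone U :=
  antitone_nat_of_succ_le fun n x hx => by simpa using hU.mul_mem n x hx 1 (hU.one_mem _)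

theorem hasBasis (hU : IsSquareRootSeq U) :
    (⨅ n, 𝓟 (U n)).HasBasis (fun _ : ℕ => True) U :=
  hasBasis_iInf_principal (directed_of_isDirected_le hU.antitone)

/-- The uniformity with entourages `{(x, y) | x⁻¹ * y ∈ U n}`. -/
@[reducible]
def uniformSpace (hU : IsSquareRootSeq U) : UniformSpace G :=
  UniformSpace.ofCore
    { uniformity := comap (fun p : G × G => p.1⁻¹ * p.2) (⨅ n, 𝓟 (U n))
      refl := by
        rw [(hU.hasBasis.comap _).ge_iff]
        rintro n - ⟨x, y⟩ hxy
        obtain rfl : x = y := hxy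
        simpa using hU.one_mem n
      symm := by
        rw [(hU.hasBasis.comap _).tendsto_iff (hU.hasBasis.comap _)]
        refine fun n _ => ⟨n, trivial, fun p hp => ?_⟩
        simpa using hU.inv_mem n _ hp
      comp := by
        refine (((hU.hasBasis.comap _).lift' (monotone_id.relComp monotone_id)).le_basis_iff
          (hU.hasBasis.comap _)).2 ?_
        refine fun n _ => ⟨n + 1, trivial, ?_⟩
        rintro ⟨x, z⟩ ⟨y, hxy, hyz⟩
        have := hU.mul_mem n _ hxy _ hyz
        simpa [mul_assoc] using this }

theorem hasBasis_nhds (hU : IsSquareRootSeq U) (x : G) :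
    (@nhds G hU.uniformSpace.toTopologicalSpace x).HasBasis (fun _ : ℕ => True)
      (fun n => {y | x⁻¹ * y ∈ U n}) := by
  let := hU.uniformSpace
  rw [nhds_eq_comap_uniformity]
  exact (hU.hasBasis.comap _).comap (Prod.mk x)

theorem pseudoMetrizableSpace (hU : IsSquareRootSeq U) :
    @TopologicalSpace.PseudoMetrizableSpace G hU.uniformSpace.toTopologicalSpace := by
  let := hU.uniformSpace
  have : (uniformity G).IsCountablyGenerated :=
    (hU.hasBasis.comap (fun p : G × G => p.1⁻¹ * p.2)).isCountablyGenerated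
  infer_instance

/-- If the sets `U n` are neighborhoods of `1` in a group topology, the uniformity they generate
induces a coarser topology. -/
theorem le_uniformSpace (hU : IsSquareRootSeq U) {τ : TopologicalSpace G} [IsTopologicalGroup G]
    (h : ∀ n, U n ∈ 𝓝 1) : τ ≤ hU.uniformSpace.toTopologicalSpace := by
  refine le_of_nhds_le_nhds fun x => ?_
  rw [(hU.hasBasis_nhds x).ge_iff]
  intro n _
  have hc : ContinuousAt (fun y => x⁻¹ * y) x := by fun_prop
  exact hc (by simpa using h n)

end IsSquareRootSeq

theorem IsSquareRootSeq.isTopologicalGroup {H : Type*} [CommGroup H] {U : ℕ → Set H}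
    (hU : IsSquareRootSeq U) :
    @IsTopologicalGroup H hU.uniformSpace.toTopologicalSpace _ := by
  let := hU.uniformSpace
  have h1 := hU.hasBasis_nhds 1
  simp only [inv_one, one_mul, ofPred_mem_eq] at h1
  refine IsTopologicalGroup.of_comm_of_nhds_one ?_ ?_ fun x => ?_
  · rw [(h1.prod_self).tendsto_iff h1]
    exact fun n _ => ⟨n + 1, trivial, fun p hp => hU.mul_mem n _ hp.1 _ hp.2⟩
  · rw [h1.tendsto_iff h1]
    exact fun n _ => ⟨n, trivial, hU.inv_mem n⟩
  · refine (hU.hasBasis_nhds x).eq_of_same_basis ?_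
    refine (h1.map (x * ·)).to_hasBasis ?_ ?_ <;> refine fun n _ => ⟨n, trivial, ?_⟩
    · exact fun y hy => ⟨x⁻¹ * y, hy, by simp⟩
    · rintro _ ⟨y, hy, rfl⟩
      simpa using hy

/-- Neighborhoods of `1` contain sequences of successive square roots, in which each term can
moreover be taken inside a neighborhood of `1` that depends on the preceding term. -/
theorem exists_isSquareRootSeq {G : Type*} [Group G] [TopologicalSpace G] [IsTopologicalGroup G]
    {V : Set G} (hV : V ∈ 𝓝 1) (S : Set G → Set G) (hS : ∀ A ∈ 𝓝 (1 : G), S A ∈ 𝓝 1) :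
    ∃ U : ℕ → Set G, IsSquareRootSeq U ∧ (∀ n, U n ∈ 𝓝 1) ∧ U 0 ⊆ V ∧
      ∀ n, U (n + 1) ⊆ S (U n) := by
  have hstep : ∀ A : Set G, A ∈ 𝓝 1 → ∃ B : Set G, B ∈ 𝓝 1 ∧ (∀ x ∈ B, x⁻¹ ∈ B) ∧
      (∀ x ∈ B, ∀ y ∈ B, x * y ∈ A ∩ S A) ∧ B ⊆ A ∩ S A := by
    intro A hA
    obtain ⟨B, hB, -, hinv, hmul⟩ :=
      exists_closed_nhds_one_inv_eq_mul_subset (inter_mem hA (hS A hA))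
    exact ⟨B, hB, fun x hx => by rw [← hinv]; simpa using hx,
      fun x hx y hy => hmul (mul_mem_mul hx hy),
      fun x hx => hmul ⟨x, hx, 1, mem_of_mem_nhds hB, by simp⟩⟩
  choose! R hR hinv hmul hsub using hstep
  have hmem : ∀ n, R^[n] V ∈ 𝓝 (1 : G) := by
    intro n
    induction n with
    | zero => exact hV
    | succ n ih => rw [Function.iterate_succ_apply']; exact hR _ ih
  refine ⟨fun n => R^[n + 1] V, ⟨fun n => mem_of_mem_nhds (hmem _), fun n => ?_, fun n => ?_⟩,
    fun n => hmem _, (hsub V hV).trans inter_subset_left, fun n => ?_⟩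
  · rw [Function.iterate_succ_apply']; exact hinv _ (hmem n)
  · rw [Function.iterate_succ_apply' R (n + 1)]
    exact fun x hx y hy => (hmul _ (hmem (n + 1)) x hx y hy).1
  · beta_reduce
    rw [Function.iterate_succ_apply' R (n + 1)]
    exact (hsub _ (hmem (n + 1))).trans inter_subset_right

/-- In an `α`-pseudocompact group, all left translates of a neighborhood of `1` are detected by a
single continuous map to `ℝ ^ ℕ`. -/
theorem AlphaPseudocompact.exists_continuous_nat_real {α : Cardinal.{v}} (hα : ℵ₀ ≤ α) {G : Type u}
    [Group G] [TopologicalSpace G] [IsTopologicalGroup G] (hG : AlphaPseudocompact α G)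
    {V : Set G} (hV : V ∈ 𝓝 1) :
    ∃ φ : G → ℕ → ℝ, Continuous φ ∧ ∀ x, {y | x⁻¹ * y ∈ V} ∈ comap φ (𝓝 (φ x)) := by
  obtain ⟨U, hU, hU1, hUV, -⟩ := exists_isSquareRootSeq hV (fun _ => univ) fun _ _ => univ_mem
  have hle := hU.le_uniformSpace hU1
  have hpm := hU.pseudoMetrizableSpace
  have hcpt := hG.compactSpace_of_le hα hle hpm
  obtain ⟨φ, hφ, hnhds⟩ := @exists_nhds_eq_comap_nat_real G hU.uniformSpace.toTopologicalSpace hpm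
    (@TopologicalSpace.SecondCountableTopology.to_separableSpace G
      hU.uniformSpace.toTopologicalSpace (@secondCountableTopology_of_compactSpace G
        hU.uniformSpace.toTopologicalSpace hpm hcpt)) ⟨1⟩
  refine ⟨φ, continuous_le_dom hle hφ, fun x => ?_⟩
  rw [← hnhds]
  exact mem_of_superset ((hU.hasBasis_nhds x).mem_of_mem (i := 0) trivial) fun y hy => hUV hy

/-! ### Compact coarsenings and uniform continuity -/

/-- Any `ι`-indexed family of neighborhoods of `1` consists, together with all left translates, of
neighborhoods for some compact topology, not necessarily Hausdorff or compatible with the group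
operations. -/
def HasCompactCoarsenings (ι : Type*) (G : Type*) [Group G] [TopologicalSpace G] : Prop :=
  ∀ U : ι → Set G, (∀ i, U i ∈ 𝓝 1) → ∃ σ : TopologicalSpace G, @CompactSpace G σ ∧
    ∀ i x, {y | x⁻¹ * y ∈ U i} ∈ @nhds G σ x

theorem HasCompactCoarsenings.of_surjective {ι κ G : Type*} [Group G] [TopologicalSpace G]
    (hG : HasCompactCoarsenings ι G) {e : ι → κ} (he : Function.Surjective e) :
    HasCompactCoarsenings κ G := by
  intro U hU
  obtain ⟨σ, hσ, h⟩ := hG (U ∘ e) fun i => hU _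
  exact ⟨σ, hσ, he.forall.2 h⟩

theorem exists_frequently_of_compactSpace {G : Type*} [Group G] [TopologicalSpace G]
    [CompactSpace G] {ι : Type*} {U : ι → Set G} (hU : ∀ i x, {y | x⁻¹ * y ∈ U i} ∈ 𝓝 x)
    (x : ℕ → G) : ∃ p, ∀ i, ∃ᶠ n in atTop, p⁻¹ * x n ∈ U i := by
  obtain ⟨p, hp⟩ := exists_clusterPt_of_compactSpace (map x atTop)
  have h : MapClusterPt p atTop x := hp
  exact ⟨p, fun i => h.frequently (hU i p)⟩

/-- With `N = ⋂ n, U n`, every neighborhood `V` of `1` satisfies `U k ⊆ V * N` for some `k`. This is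
the openness of the quotient map modulo `N`, as a compactness statement. -/
theorem HasCompactCoarsenings.exists_forall_mul_mem {G : Type*} [Group G] [TopologicalSpace G]
    [IsTopologicalGroup G] (hG : HasCompactCoarsenings ℕ G) {U : ℕ → Set G}
    (hU : IsSquareRootSeq U) (hU1 : ∀ n, U n ∈ 𝓝 1) {V : Set G} (hV : V ∈ 𝓝 1) :
    ∃ k, ∀ z ∈ U k, ∃ m, (∀ n, m ∈ U n) ∧ z * m ∈ V := by
  by_contra! hcon
  choose z hz hzV using hcon
  -- A cluster point `q` of `(z n)⁻¹` for a topology in which the `U n` and `V⁻¹` are neighborhoods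
  -- of `1` lies in `⋂ n, U n`, and `z j * q ∈ V` for some `j`.
  obtain ⟨σ, hσ, hσU⟩ := hG.of_surjective (e := fun n => n.casesOn none some)
    (κ := Option ℕ) (by rintro (_ | n); exacts [⟨0, rfl⟩, ⟨n + 1, rfl⟩])
    (fun o => o.elim {v | v⁻¹ ∈ V} U) (by
      rintro (_ | n)
      · exact continuous_inv.continuousAt (by simpa using hV)
      · exact hU1 n)
  obtain ⟨q, hq⟩ := @exists_frequently_of_compactSpace G _ σ hσ _ _ hσU fun n => (z n)⁻¹
  have hqU : ∀ n, q ∈ U n := by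
    intro n
    obtain ⟨j, hj, hjn⟩ := ((hq (some (n + 1))).and_eventually (eventually_ge_atTop (n + 1))).exists
    have h1 := hU.mul_mem n _ hj _ (hU.antitone hjn (hz j))
    simpa using hU.inv_mem n _ h1
  obtain ⟨j, hj⟩ := (hq none).exists
  exact hzV j q hqU (by simpa using hj)

/-- If countable families of neighborhoods of `1` have compact coarsenings, continuous real
functions are left uniformly continuous. Otherwise there are `ε` and points `x n`, `x n * u n`,
with `u n ∈ U n`, at which `f` differs by `ε`, while `f` varies little on `x n * U (n + 1)` and
`x n * u n * U (n + 1)`. With `N = ⋂ n, U n` and `p` a cluster point of `x`, the cosets `x n * N`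
and `x n * u n * N` meet any given neighborhood of `p`, on which `f` varies little. -/
theorem HasCompactCoarsenings.exists_nhds_dist_lt {G : Type*} [Group G] [TopologicalSpace G]
    [IsTopologicalGroup G] (hG : HasCompactCoarsenings ℕ G) {f : G → ℝ} (hf : Continuous f)
    {ε : ℝ} (hε : 0 < ε) : ∃ U ∈ 𝓝 (1 : G), ∀ x, ∀ u ∈ U, dist (f (x * u)) (f x) < ε := by
  by_contra! hcon
  choose! x u hu hd using hcon
  have hosc : ∀ a, {m | dist (f (a * m)) (f a) < ε / 4} ∈ 𝓝 (1 : G) := fun a =>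
    (isOpen_lt (by fun_prop) continuous_const).mem_nhds (by simp; positivity)
  obtain ⟨U, hU, hU1, -, hUS⟩ := exists_isSquareRootSeq (G := G) univ_mem
    (fun A => {m | dist (f (x A * m)) (f (x A)) < ε / 4} ∩
      {m | dist (f (x A * u A * m)) (f (x A * u A)) < ε / 4})
    fun A _ => inter_mem (hosc _) (hosc _)
  obtain ⟨p, hp⟩ : ∃ p, ∀ k, ∃ᶠ n in atTop, p⁻¹ * x (U n) ∈ U k := by
    obtain ⟨σ, hσ, hσU⟩ := hG U hU1
    exact @exists_frequently_of_compactSpace G _ σ hσ _ _ hσU fun n => x (U n)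
  obtain ⟨k, hk⟩ := hG.exists_forall_mul_mem hU hU1 (hosc p)
  obtain ⟨n, hn, hkn⟩ := ((hp (k + 1)).and_eventually (eventually_ge_atTop (k + 1))).exists
  have hn' : p⁻¹ * (x (U n) * u (U n)) ∈ U k := by
    have := hU.mul_mem k _ hn _ (hU.antitone hkn (hu _ (hU1 n)))
    rwa [mul_assoc] at this
  obtain ⟨m, hmU, hm⟩ := hk _ (hU.antitone k.le_succ hn)
  obtain ⟨m', hmU', hm'⟩ := hk _ hn'
  have h1 := (hUS n (hmU _)).1
  have h2 := (hUS n (hmU' _)).2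
  have h3 := hd _ (hU1 n)
  simp only [mem_ofPred_eq, mul_assoc, mul_inv_cancel_left] at hm hm' h1 h2
  have h4 := dist_triangle4 (f (x (U n) * u (U n))) (f (x (U n) * (u (U n) * m')))
    (f (x (U n) * m)) (f (x (U n)))
  have h5 := dist_triangle_right (f (x (U n) * (u (U n) * m'))) (f (x (U n) * m)) (f p)
  rw [dist_comm] at h2
  linarith

/-- If `α`-indexed families of neighborhoods of `1` have compact coarsenings, the group is
`α`-pseudocompact: by uniform continuity, a continuous map to `ℝ ^ α` remains continuous for some
compact topology. -/
theorem HasCompactCoarsenings.alphaPseudocompact {α : Cardinal.{v}} (hα : ℵ₀ ≤ α) {G : Type u}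
    [Group G] [TopologicalSpace G] [IsTopologicalGroup G]
    (hG : HasCompactCoarsenings α.out G) : AlphaPseudocompact α G := by
  obtain ⟨e⟩ := nonempty_equiv_out_prod_nat hα
  have hne := nonempty_out hα
  have hN : HasCompactCoarsenings ℕ G :=
    hG.of_surjective (Prod.snd_surjective.comp e.surjective)
  intro F hF
  have hunif : ∀ j : α.out × ℕ, ∃ U ∈ 𝓝 (1 : G), ∀ x, ∀ u ∈ U,
      dist (F (x * u) j.1) (F x j.1) < 1 / (j.2 + 1) := fun j =>
    hN.exists_nhds_dist_lt (f := fun x => F x j.1) (by fun_prop) (by positivity)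
  choose U hU1 hU using hunif
  obtain ⟨σ, hσ, hσU⟩ := hG.of_surjective e.surjective U hU1
  have hc : @Continuous _ _ σ _ F := by
    refine continuous_pi fun i => ?_
    rw [@continuous_iff_continuousAt _ _ σ]
    intro x
    unfold ContinuousAt
    rw [Metric.tendsto_nhds]
    intro ε hε
    obtain ⟨k, hk⟩ := exists_nat_one_div_lt hε
    filter_upwards [hσU (i, k) x] with y hy
    simpa using (hU (i, k) x _ hy).trans hk
  exact @isCompact_range _ _ σ _ hσ F hc

/-! ### Refining a group topology by a transversal second countable one -/

/-- Every non-empty `G_α`-set of `τ` meets every class of points inseparable for `ρ`. -/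
def IsGAlphaTransversal (α : Cardinal.{v}) {X : Type u} (τ ρ : TopologicalSpace X) : Prop :=
  ∀ W : Set X, @IsGAlphaSet α X τ W → W.Nonempty → ∀ x, ∃ g ∈ W, @Inseparable X ρ g x

theorem isGAlphaSet_iInter {α : Cardinal.{v}} {ι : Type*} {e : α.out → ι}
    (he : Function.Surjective e) {X : Type u} [TopologicalSpace X] {U : ι → Set X}
    (hU : ∀ i, IsOpen (U i)) : IsGAlphaSet α (⋂ i, U i) :=
  ⟨U ∘ e, fun _ => hU _, (he.iInter_comp U).symm⟩

theorem IsOpen.isGAlphaSet {α : Cardinal.{v}} (hα : ℵ₀ ≤ α) {X : Type u} [TopologicalSpace X]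
    {U : Set X} (hU : IsOpen U) : IsGAlphaSet α U := by
  have hne := nonempty_out hα
  exact ⟨fun _ => U, fun _ => hU, (iInter_const U).symm⟩

/-- Fibers of continuous maps to `ℝ ^ α` are `G_α`-sets. -/
theorem isGAlphaSet_preimage_singleton {α : Cardinal.{v}} (hα : ℵ₀ ≤ α) {X : Type u}
    [TopologicalSpace X] {Φ : X → α.out → ℝ} (hΦ : Continuous Φ) (z : α.out → ℝ) :
    IsGAlphaSet α (Φ ⁻¹' {z}) := by
  obtain ⟨e⟩ := nonempty_equiv_out_prod_nat hα
  have h : Φ ⁻¹' {z} = ⋂ j : α.out × ℕ, {x | dist (Φ x j.1) (z j.1) < 1 / (j.2 + 1)} := by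
    ext x
    simp only [mem_preimage, mem_singleton_iff, mem_iInter, mem_ofPred_eq, Prod.forall]
    refine ⟨?_, fun h => funext fun i => ?_⟩
    · rintro rfl i n
      rw [dist_self]
      positivity
    · refine dist_le_zero.1 (le_of_forall_pos_lt_add fun ε hε => ?_)
      obtain ⟨n, hn⟩ := exists_nat_one_div_lt hε
      simpa using (h i n).trans hn
  rw [h]
  exact isGAlphaSet_iInter e.surjective fun j =>
    isOpen_lt (by fun_prop) continuous_const

/-- A limit for the first topology and a limit for the second one are replaced by a common limit,
which transversality provides. -/
theorem compactSpace_inf_induced {α : Cardinal.{v}} (hα : ℵ₀ ≤ α) {X : Type u}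
    {τ ρ : TopologicalSpace X} (hτρ : IsGAlphaTransversal α τ ρ)
    (hX : @AlphaPseudocompact α X τ) (hρ : @CompactSpace X ρ) {Φ : X → α.out → ℝ}
    (hΦ : @Continuous _ _ τ _ Φ) : @CompactSpace X (induced Φ inferInstance ⊓ ρ) := by
  refine @CompactSpace.mk X (_) (@isCompact_iff_ultrafilter_le_nhds X (_) univ |>.2 fun F _ => ?_)
  obtain ⟨y, -, hy⟩ := @isCompact_iff_ultrafilter_le_nhds X ρ univ |>.1 hρ.1 F (by simp)
  obtain ⟨_, ⟨x, rfl⟩, hx⟩ := isCompact_iff_ultrafilter_le_nhds.1 (hX Φ hΦ) (F.map Φ)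
    (le_principal_iff.2 (range_mem_map))
  obtain ⟨g, hg, hgy⟩ := hτρ _ (@isGAlphaSet_preimage_singleton α hα X τ Φ hΦ (Φ x)) ⟨x, rfl⟩ y
  refine ⟨g, mem_univ _, ?_⟩
  rw [_root_.nhds_inf (t₁ := induced Φ inferInstance) (t₂ := ρ), nhds_induced,
    show Φ g = Φ x from hg,
    show @nhds X ρ g = @nhds X ρ y from hgy]
  exact le_inf (map_le_iff_le_comap.1 hx) hy

theorem hasCompactCoarsenings_inf {α : Cardinal.{v}} (hα : ℵ₀ ≤ α) {G : Type u} [Group G]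
    {τ ρ : TopologicalSpace G} (hτρ : IsGAlphaTransversal α τ ρ) (hτ : @IsTopologicalGroup G τ _)
    (hG : @AlphaPseudocompact α G τ) (hρ : @IsTopologicalGroup G ρ _) (hρc : @CompactSpace G ρ) :
    @HasCompactCoarsenings α.out G _ (τ ⊓ ρ) := by
  intro U hU
  obtain ⟨e⟩ := nonempty_equiv_out_prod_nat hα
  have hU' : ∀ i, ∃ V ∈ @nhds G τ 1, ∃ R ∈ @nhds G ρ 1, V ∩ R ⊆ U i := fun i => by
    have := hU i
    rwa [_root_.nhds_inf (t₁ := τ) (t₂ := ρ), mem_inf_iff_superset] at this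
  choose V hV R hR hVR using hU'
  choose φ hφ hφV using fun i => @AlphaPseudocompact.exists_continuous_nat_real α hα G _ τ hτ hG
    (V i) (hV i)
  let Φ : G → α.out → ℝ := fun x i => φ (e i).1 x (e i).2
  have hΦ : @Continuous _ _ τ _ Φ := by
    refine @continuous_pi _ _ _ τ _ _ fun i => ?_
    exact @Continuous.comp _ _ _ τ _ _ _ _ (continuous_apply (e i).2) (hφ (e i).1)
  refine ⟨_, compactSpace_inf_induced hα hτρ hG hρc hΦ, fun i x => ?_⟩
  rw [_root_.nhds_inf (t₁ := induced Φ inferInstance) (t₂ := ρ), nhds_induced,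
    mem_inf_iff_superset]
  refine ⟨_, ?_, {y | x⁻¹ * y ∈ R i}, ?_, fun y hy => hVR i hy⟩
  · let π : (α.out → ℝ) → ℕ → ℝ := fun z n => z (e.symm (i, n))
    have hπ : π ∘ Φ = φ i := by ext x n; simp [π, Φ]
    have hc : Tendsto π (𝓝 (Φ x)) (𝓝 (φ i x)) := by
      rw [← hπ]
      exact Continuous.tendsto (by fun_prop) (Φ x)
    have h := hφV i x
    rw [← hπ, ← comap_comap, hπ] at h
    exact comap_mono (tendsto_iff_comap.1 hc) h
  · have hc : @ContinuousAt G G ρ ρ (fun y => x⁻¹ * y) x := by fun_prop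
    exact hc (by simpa using hR i)

/-! ### Weight -/

theorem topWeight_le {X : Type u} [TopologicalSpace X] {B : Set (Set X)}
    (hB : IsTopologicalBasis B) : topWeight X ≤ #B :=
  csInf_le' ⟨B, hB, rfl⟩

theorem exists_isTopologicalBasis_mk_eq_topWeight (X : Type u) [TopologicalSpace X] :
    ∃ B : Set (Set X), IsTopologicalBasis B ∧ #B = topWeight X :=
  csInf_mem (s := {c : Cardinal.{u} | ∃ B : Set (Set X), IsTopologicalBasis B ∧ #B = c})
    ⟨_, _, isTopologicalBasis_opens, rfl⟩

theorem aleph0_le_topWeight (X : Type u) [TopologicalSpace X] [T0Space X] [Infinite X] :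
    ℵ₀ ≤ topWeight X := by
  obtain ⟨B, hB, hBw⟩ := exists_isTopologicalBasis_mk_eq_topWeight X
  rw [← hBw]
  by_contra! hfin
  have : Finite B := Cardinal.lt_aleph0_iff_finite.1 hfin
  have hinj : Function.Injective fun x : X => {b : B | x ∈ (b : Set X)} := by
    intro x y hxy
    refine (hB.inseparable_iff.2 fun b hb => ?_).eq
    exact Set.ext_iff.1 hxy ⟨b, hb⟩
  exact not_finite_iff_infinite.2 ‹Infinite X› (Finite.of_injective _ hinj)

theorem topWeight_subtype_le {X : Type u} [TopologicalSpace X] (s : Set X) :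
    topWeight s ≤ topWeight X := by
  obtain ⟨B, hB, hBw⟩ := exists_isTopologicalBasis_mk_eq_topWeight X
  rw [← hBw]
  exact (topWeight_le (hB.isInducing IsInducing.subtypeVal)).trans Cardinal.mk_image_le

theorem topWeight_inf_le {X : Type u} (τ ρ : TopologicalSpace X)
    (hρ : @SecondCountableTopology X ρ) (hτ : ℵ₀ ≤ @topWeight X τ) :
    @topWeight X (τ ⊓ ρ) ≤ @topWeight X τ := by
  obtain ⟨B, hB, hBw⟩ := @exists_isTopologicalBasis_mk_eq_topWeight X τ
  obtain ⟨C, hC, -, hCb⟩ := @exists_countable_basis X ρ hρ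
  refine (@topWeight_le X (τ ⊓ ρ) _ (hB.inf hCb)).trans ?_
  refine (Cardinal.mk_image2_le).trans ?_
  rw [hBw]
  exact (mul_le_mul_right (Cardinal.le_aleph0_iff_set_countable.2 hC) _).trans
    (Cardinal.mul_aleph0_eq hτ).le

/-- A homomorphism of topological groups with dense range that is almost open does not raise the
weight: the translates, by one point from each member of a base of the source, of the interiors of
the closures of the images of the basic neighborhoods of `1` form a base of the target. -/
theorem topWeight_le_of_denseRange {A B : Type u} [Group A] [TopologicalSpace A] [Group B]
    [TopologicalSpace B] [IsTopologicalGroup B] (i : A →* B) (hi : Continuous i)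
    (hd : DenseRange i) (ho : ∀ V ∈ 𝓝 (1 : A), closure (i '' V) ∈ 𝓝 (1 : B))
    (hA : ℵ₀ ≤ topWeight A) : topWeight B ≤ topWeight A := by
  obtain ⟨𝓑, h𝓑, hw⟩ := exists_isTopologicalBasis_mk_eq_topWeight A
  have hsel : ∀ b : Set A, ∃ a, b.Nonempty → a ∈ b := fun b => by
    by_cases hb : b.Nonempty
    · exact ⟨hb.some, fun _ => hb.some_mem⟩
    · exact ⟨1, fun h => absurd h hb⟩
  choose a ha using hsel
  let T : Set A → Set B := fun c => interior (closure (i '' c))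
  let 𝓒 : Set (Set B) := range fun p : 𝓑 × 𝓑 => (fun z => (i (a p.1))⁻¹ * z) ⁻¹' T p.2
  have h𝓒 : IsTopologicalBasis 𝓒 := by
    -- For `y ∈ O` take `T c ⊆ W` with `y * W⁻¹ * W ⊆ O`. The set `y * (T c)⁻¹` contains the image of
    -- some basic set `b`, and then `y ∈ i (a b) * T c ⊆ y * (T c)⁻¹ * T c ⊆ O`.
    refine isTopologicalBasis_of_isOpen_of_nhds ?_ ?_
    · rintro _ ⟨p, rfl⟩
      exact isOpen_interior.preimage (by fun_prop)
    intro y O hy hO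
    have hO1 : (fun z => y * z) ⁻¹' O ∈ 𝓝 (1 : B) :=
      (hO.preimage (by fun_prop)).mem_nhds (by simpa using hy)
    obtain ⟨W, hW, hWc, hWinv, hWW⟩ := exists_closed_nhds_one_inv_eq_mul_subset hO1
    obtain ⟨c, hc, hc1, hcW⟩ := h𝓑.mem_nhds_iff.1
      (hi.continuousAt.preimage_mem_nhds (by rwa [map_one]) : i ⁻¹' W ∈ 𝓝 1)
    have hT1 : T c ∈ 𝓝 (1 : B) := interior_mem_nhds.2 (ho c (h𝓑.mem_nhds hc hc1))
    have hTW : T c ⊆ W :=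
      interior_subset.trans (closure_minimal (image_subset_iff.2 hcW) hWc)
    have hopen : IsOpen {z : B | z⁻¹ * y ∈ T c} := isOpen_interior.preimage (by fun_prop)
    obtain ⟨x, hx⟩ := hd.exists_mem_open hopen ⟨y, by simpa using mem_of_mem_nhds hT1⟩
    obtain ⟨b, hb, hxb, hbs⟩ := h𝓑.exists_subset_of_mem_open hx (hopen.preimage hi)
    refine ⟨_, ⟨(⟨b, hb⟩, ⟨c, hc⟩), rfl⟩, hbs (ha b ⟨x, hxb⟩), fun z hz => ?_⟩
    have h1 : ((i (a b))⁻¹ * y)⁻¹ ∈ W := by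
      rw [← hWinv]
      simpa using hTW (hbs (ha b ⟨x, hxb⟩))
    have h2 := hWW (mul_mem_mul h1 (hTW hz))
    simpa [mul_assoc] using h2
  calc topWeight B ≤ #𝓒 := topWeight_le h𝓒
    _ ≤ #(𝓑 × 𝓑) := Cardinal.mk_range_le
    _ = topWeight A := by rw [← Cardinal.mul_def, hw, Cardinal.mul_eq_self hA]

theorem IsGAlphaDense.dense {α : Cardinal.{v}} (hα : ℵ₀ ≤ α) {X : Type u} [TopologicalSpace X]
    {D : Set X} (hD : IsGAlphaDense α D) : Dense D :=
  dense_iff_inter_open.2 fun _ hU hne => hD _ (hU.isGAlphaSet hα) hne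

/-- A dense subgroup of a Hausdorff group has the weight of the group, unless it is finite. -/
theorem topWeight_eq_of_dense {G : Type u} [Group G] [TopologicalSpace G] [IsTopologicalGroup G]
    [T2Space G] (D : Subgroup G) [Infinite D] (hD : Dense (D : Set G)) :
    topWeight D = topWeight G := by
  refine le_antisymm (topWeight_subtype_le _) (topWeight_le_of_denseRange D.subtype
    continuous_subtype_val (by simpa [DenseRange] using hD) (fun V hV => ?_)
    (aleph0_le_topWeight D))
  obtain ⟨O, hO, hOV⟩ := mem_nhds_subtype (D : Set G) 1 V |>.1 hV
  have hO' : interior O ∈ 𝓝 (1 : G) := interior_mem_nhds.2 hO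
  refine mem_of_superset hO' ((hD.open_subset_closure_inter isOpen_interior).trans
    (closure_mono ?_))
  rintro x ⟨hxO, hxD⟩
  exact ⟨⟨x, hxD⟩, hOV (show x ∈ O from interior_subset hxO), rfl⟩

/-! ### The two conclusions for a transversal topology -/

section Transversal

variable {α : Cardinal.{v}} {G : Type u} {τ ρ : TopologicalSpace G}

theorem IsGAlphaTransversal.exists_mem_inter (hτρ : IsGAlphaTransversal α τ ρ) (hα : ℵ₀ ≤ α)
    {O R : Set G} (hO : IsOpen[τ] O) (hOne : O.Nonempty) (hR : IsOpen[ρ] R) (hRne : R.Nonempty) :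
    (O ∩ R).Nonempty := by
  obtain ⟨x, hx⟩ := hRne
  obtain ⟨g, hgO, hgx⟩ := hτρ O (@IsOpen.isGAlphaSet α hα G τ O hO) hOne x
  exact ⟨g, hgO, (@Inseparable.mem_open_iff G ρ g x R hgx hR).2 hx⟩

variable [Group G]

theorem IsGAlphaTransversal.infinite (hτρ : IsGAlphaTransversal α τ ρ) (hα : ℵ₀ ≤ α)
    (hτ : @T2Space G τ) (hρ : ∃ x, ¬ @Inseparable G ρ 1 x) : Infinite G := by
  by_contra hfin
  rw [not_infinite_iff_finite] at hfin
  obtain ⟨x, hx⟩ := hρ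
  -- Otherwise `{1}` is open, and every point is `ρ`-inseparable from `1`.
  have hd : @DiscreteTopology G τ := inferInstance
  obtain ⟨g, rfl, hg⟩ := hτρ {1}
    (@IsOpen.isGAlphaSet α hα G τ _ (@isOpen_discrete G τ hd _)) ⟨1, rfl⟩ x
  exact hx hg

theorem IsGAlphaTransversal.topWeight_inf (hτρ : IsGAlphaTransversal α τ ρ) (hα : ℵ₀ ≤ α)
    (hτ : @IsTopologicalGroup G τ _) (hτ2 : @T2Space G τ) [Infinite G]
    (hρ : @SecondCountableTopology G ρ) : @topWeight G (τ ⊓ ρ) = @topWeight G τ := by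
  have h2 : @T2Space G (τ ⊓ ρ) := t2Space_antitone inf_le_left hτ2
  refine le_antisymm (topWeight_inf_le τ ρ hρ (@aleph0_le_topWeight G τ inferInstance _)) ?_
  refine @topWeight_le_of_denseRange G G _ (τ ⊓ ρ) _ τ hτ (MonoidHom.id G)
    (continuous_id_of_le inf_le_left) (@Function.Surjective.denseRange G τ _ _ fun x => ⟨x, rfl⟩)
    (fun V hV => ?_) (@aleph0_le_topWeight G (τ ⊓ ρ) inferInstance _)
  -- If `V ⊇ O' ∩ R'` with `O'` open for `τ` and `R'` open for `ρ`, then `O'` lies in the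
  -- `τ`-closure of `V`, since `R'` meets every non-empty `τ`-open set.
  rw [_root_.nhds_inf (t₁ := τ) (t₂ := ρ), mem_inf_iff_superset] at hV
  obtain ⟨O, hO, R, hR, hORV⟩ := hV
  obtain ⟨O', hO'O, hO', hO1⟩ := (@mem_nhds_iff G τ 1 O).1 hO
  obtain ⟨R', hR'R, hR', hR1⟩ := (@mem_nhds_iff G ρ 1 R).1 hR
  refine mem_of_superset (@IsOpen.mem_nhds G τ 1 _ hO' hO1) fun y hy => ?_
  rw [@mem_closure_iff G τ]
  intro P hP hyP
  obtain ⟨z, ⟨hzP, hzO⟩, hzR⟩ := hτρ.exists_mem_inter hα (@IsOpen.inter G τ P O' hP hO')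
    ⟨y, hyP, hy⟩ hR' ⟨1, hR1⟩
  exact ⟨z, hzP, z, hORV ⟨hO'O hzO, hR'R hzR⟩, rfl⟩

theorem IsGAlphaTransversal.inf_lt (hτρ : IsGAlphaTransversal α τ ρ) (hα : ℵ₀ ≤ α)
    (hρ : ∃ x, ¬ @Inseparable G ρ 1 x) : τ ⊓ ρ < τ := by
  refine lt_of_le_of_ne inf_le_left fun heq => ?_
  have hle : τ ≤ ρ := heq ▸ inf_le_right
  obtain ⟨x, hx⟩ := hρ
  rw [@inseparable_iff_forall_isOpen G ρ] at hx
  push Not at hx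
  obtain ⟨R, hR, h⟩ := hx
  rcases h with ⟨h1, h2⟩ | ⟨h1, h2⟩
  · obtain ⟨g, hg, hgx⟩ := hτρ R (@IsOpen.isGAlphaSet α hα G τ _ (hle R hR)) ⟨1, h1⟩ x
    exact h2 ((@Inseparable.mem_open_iff G ρ g x R hgx hR).1 hg)
  · obtain ⟨g, hg, hgx⟩ := hτρ R (@IsOpen.isGAlphaSet α hα G τ _ (hle R hR)) ⟨x, h2⟩ 1
    exact h1 ((@Inseparable.mem_open_iff G ρ g 1 R hgx hR).1 hg)

/-- The subgroup is the class of `1` for inseparability with respect to `ρ`. -/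
theorem IsGAlphaTransversal.exists_subgroup (hτρ : IsGAlphaTransversal α τ ρ)
    (hρ : @IsTopologicalGroup G ρ _) (hne : ∃ x, ¬ @Inseparable G ρ 1 x) :
    ∃ D : Subgroup G, D ≠ ⊤ ∧ @IsGAlphaDense α G τ D := by
  let D : Subgroup G :=
    { carrier := {g | @Inseparable G ρ g 1}
      one_mem' := @Inseparable.refl G ρ 1
      mul_mem' := fun {a b} ha hb => by
        simpa using @Inseparable.mul G ρ _ _ a 1 b 1 ha hb
      inv_mem' := fun {a} ha => by
        simpa using @Inseparable.inv G ρ _ _ a 1 ha }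
  refine ⟨D, fun htop => ?_, fun W hW hWne => hτρ W hW hWne 1⟩
  obtain ⟨x, hx⟩ := hne
  have hxD : x ∈ D := htop ▸ Subgroup.mem_top x
  exact hx (@Inseparable.symm G ρ x 1 hxD)

end Transversal

/-! ### The transversal topology of a homomorphism with `G_α`-dense graph -/

/-- If the graph of `h` is `G_α`-dense, every non-empty `G_α`-set of `G` contains points with image
in a prescribed inseparability class, for any coarser pseudometrizable topology on `H`. -/
theorem IsGAlphaDense.exists_inseparable {α : Cardinal.{v}} (hα : ℵ₀ ≤ α) {G : Type u}
    {H : Type w} [TopologicalSpace G] {σ : TopologicalSpace H} [τH : TopologicalSpace H] {h : G → H}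
    (hgraph : IsGAlphaDense α {p : G × H | h p.1 = p.2}) (hσ : τH ≤ σ)
    (hσpm : @PseudoMetrizableSpace H σ) {W : Set G} (hW : IsGAlphaSet α W) (hne : W.Nonempty)
    (y : H) : ∃ g ∈ W, @Inseparable H σ (h g) y := by
  obtain ⟨e⟩ := nonempty_equiv_out_prod_nat hα
  obtain ⟨O, hO, rfl⟩ := hW
  obtain ⟨x, hx⟩ := hne
  have hfc : @FirstCountableTopology H σ := inferInstance
  have hcg : (@nhds H σ y).IsCountablyGenerated := hfc.nhds_generated_countable y
  obtain ⟨V, hV⟩ := (@nhds H σ y).exists_antitone_basis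
  have hVy : ∀ n, y ∈ @interior H σ (V n) := fun n =>
    (@mem_interior_iff_mem_nhds H σ y (V n)).2 (hV.mem n)
  have hA : IsGAlphaSet α (⋂ j : α.out × ℕ, O j.1 ×ˢ @interior H σ (V j.2)) :=
    isGAlphaSet_iInter e.surjective fun j => (hO j.1).prod (hσ _ (@isOpen_interior H σ (V j.2)))
  obtain ⟨⟨g, z⟩, hgz, hz⟩ := hgraph _ hA
    ⟨(x, y), mem_iInter.2 fun j => ⟨mem_iInter.1 hx j.1, hVy j.2⟩⟩
  obtain rfl : h g = z := hz
  rw [mem_iInter] at hgz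
  have hne := nonempty_out hα
  have hV' : ∀ n, h g ∈ V n := fun n =>
    @interior_subset H σ (V n) _ (hgz (hne.some, n)).2
  have hspec : @Specializes H σ (h g) y := (@specializes_iff_pure H σ _ _).2
    (hV.toHasBasis.ge_iff.2 fun n _ => hV' n)
  have hR0 : @R0Space H σ := inferInstance
  exact ⟨g, mem_iInter.2 fun i => (hgz (i, 0)).1, @Specializes.inseparable H σ hR0 _ _ hspec⟩

/-- The topology `ρ` is induced by `h` from a coarser group topology `σ` on `H` that separates `1`
from some other point. Every class of `σ`-inseparable points meets the range of `h`, whence the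
compactness of `ρ`. -/
theorem exists_transversal {α : Cardinal.{v}} (hα : ℵ₀ ≤ α) {G : Type u} [Group G]
    [τ : TopologicalSpace G] {H : Type w} [CommGroup H] [τH : TopologicalSpace H]
    [IsTopologicalGroup H] [T2Space H] (hH : AlphaPseudocompact α H) [Nontrivial H] (h : G →* H)
    (hgraph : IsGAlphaDense α (h.graph : Set (G × H))) :
    ∃ ρ : TopologicalSpace G, @IsTopologicalGroup G ρ _ ∧ @CompactSpace G ρ ∧
      @SecondCountableTopology G ρ ∧ (∃ x, ¬ @Inseparable G ρ 1 x) ∧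
      IsGAlphaTransversal α τ ρ := by
  obtain ⟨y, hy⟩ := exists_ne (1 : H)
  obtain ⟨U, hU, hU1, hUy, -⟩ := exists_isSquareRootSeq
    (isOpen_compl_singleton.mem_nhds (show (1 : H) ∈ ({y} : Set H)ᶜ from hy.symm))
    (fun _ => univ) fun _ _ => univ_mem
  have hle := hU.le_uniformSpace hU1
  have hpm := hU.pseudoMetrizableSpace
  have hgrp := hU.isTopologicalGroup
  have hnhds := hU.hasBasis_nhds 1
  generalize hU.uniformSpace.toTopologicalSpace = σ at hle hpm hgrp hnhds
  have hcpt : @CompactSpace H σ := AlphaPseudocompact.compactSpace_of_le hα (τ := τH) hH hle hpm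
  have hsc : @SecondCountableTopology H σ := @secondCountableTopology_of_compactSpace H σ hpm hcpt
  have hmeet : ∀ W : Set G, IsGAlphaSet α W → W.Nonempty → ∀ z, ∃ g ∈ W, @Inseparable H σ (h g) z :=
    fun W hW hne z =>
      @IsGAlphaDense.exists_inseparable α hα G H τ σ τH h hgraph hle hpm W hW hne z
  have huniv : ∀ z, ∃ g, @Inseparable H σ (h g) z := fun z => by
    obtain ⟨g, -, hg⟩ := hmeet univ (isOpen_univ.isGAlphaSet hα) ⟨1, trivial⟩ z
    exact ⟨g, hg⟩
  have hins : ∀ a b, @Inseparable H σ (h a) (h b) → @Inseparable G (induced h σ) a b := by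
    intro a b hab
    unfold Inseparable at hab ⊢
    rw [nhds_induced, nhds_induced, hab]
  refine ⟨induced h σ, topologicalGroup_induced h, ?_,
    @secondCountableTopology_induced G H σ hsc h, ?_, fun W hW hne x => ?_⟩
  · refine @CompactSpace.mk G (_) (@isCompact_iff_ultrafilter_le_nhds G (_) univ |>.2 fun F _ => ?_)
    obtain ⟨z, -, hz⟩ := @isCompact_iff_ultrafilter_le_nhds H σ univ |>.1 hcpt.1 (F.map h) (by simp)
    obtain ⟨g, hg⟩ := huniv z
    refine ⟨g, mem_univ _, ?_⟩
    rw [nhds_induced, show @nhds H σ (h g) = @nhds H σ z from hg]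
    exact map_le_iff_le_comap.1 hz
  · obtain ⟨g, hg⟩ := huniv y
    refine ⟨g, fun h1 => ?_⟩
    have h2 : @Inseparable H σ (h 1) (h g) :=
      @Inseparable.map G H (induced h σ) σ 1 g h h1 continuous_induced_dom
    have h3 : @nhds H σ 1 = @nhds H σ y := by
      have := @Inseparable.trans H σ _ _ _ h2 hg
      rwa [map_one] at this
    have h4 := hnhds.mem_of_mem (i := 0) trivial
    rw [h3] at h4
    exact hUy (by simpa using @mem_of_mem_nhds H σ y _ h4) rfl
  · obtain ⟨g, hgW, hg⟩ := hmeet W hW hne (h x)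
    exact ⟨g, hgW, hins _ _ hg⟩

theorem mainTheorem8 (α : Cardinal.{v}) (hα : ℵ₀ ≤ α)
    (G : Type u) [Group G] [τ : TopologicalSpace G] [IsTopologicalGroup G] [T2Space G]
    (hG : AlphaPseudocompact α G)
    (H : Type w) [CommGroup H] [TopologicalSpace H] [IsTopologicalGroup H] [T2Space H]
    (hH : AlphaPseudocompact α H) [Nontrivial H]
    (h : G →* H) (hgraph : IsGAlphaDense α (h.graph : Set (G × H))) :
    (∃ τ' : TopologicalSpace G, τ' < τ ∧ @IsTopologicalGroup G τ' _ ∧ @T2Space G τ' ∧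
      @AlphaPseudocompact α G τ' ∧ @topWeight G τ' = @topWeight G τ) ∧
    (∃ D : Subgroup G, D ≠ ⊤ ∧ IsGAlphaDense α (D : Set G) ∧ topWeight D = topWeight G) := by
  have hτ : @IsTopologicalGroup G τ _ := inferInstance
  have hτ2 : T2Space G := inferInstance
  obtain ⟨ρ, hρ, hρc, hρs, hρne, hτρ⟩ := exists_transversal hα hH h hgraph
  refine ⟨?_, ?_⟩
  · have hinf := hτρ.infinite hα hτ2 hρne
    have hg : @IsTopologicalGroup G (τ ⊓ ρ) _ := topologicalGroup_inf hτ hρ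
    exact ⟨τ ⊓ ρ, hτρ.inf_lt hα hρne, hg, t2Space_antitone inf_le_left hτ2,
      @HasCompactCoarsenings.alphaPseudocompact α hα G _ (τ ⊓ ρ) hg
        (hasCompactCoarsenings_inf hα hτρ hτ hG hρ hρc),
      hτρ.topWeight_inf hα hτ hτ2 hρs⟩
  · obtain ⟨D, hDtop, hD⟩ := hτρ.exists_subgroup hρ hρne
    clear hρ hρc hρs hρne hτρ ρ
    have hDd := hD.dense hα
    have hDinf : Infinite D := by
      by_contra hfin
      rw [not_infinite_iff_finite] at hfin
      refine hDtop (SetLike.coe_injective ?_)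
      rw [← (toFinite (D : Set G)).isClosed.closure_eq, hDd.closure_eq, Subgroup.coe_top]
    exact ⟨D, hDtop, hD, topWeight_eq_of_dense D hDd⟩
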